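/- Let $H$ be a real or complex Hilbert space with inner product $\langle\cdot,\cdot\rangle$, let $T$ be a densely defined self-adjoint operator on $H$ with domain $D(T)$ and spectrum $\sigma(T)$, and let $f\in H$. Let $\operatorname{ind} T$ denote the number of negative eigenvalues of $T$ counted with multiplicity, i.e. the sum of $\dim\ker(T-\lambda)$ over all real $\lambda<0$. Assume: * $\ker T=\{0\}$; * every negative point of $\sigma(T)$ is an eigenvalue of $T$, and $\operatorname{ind}T\le 1$; * there exists $f^*\in D(T)$ with $Tf^*=f$ and $\langle f,f^*\rangle<0$. Then: (a) $\langle Tv,v\rangle>0$ for every $v\in D(T)$ with $v\neq 0$ and $\langle v,f\rangle=0$. (b) Let $\mu=\inf\big(\sigma(T)\cap[0,\infty)\big)$ be the bottom of the nonnegative spectrum of $T$. If $\mu>0$, then $$\mu^*=\inf\{\langle Tv,v\rangle : v\in D(T),\ \|v\|=1,\ \langle v,f\rangle=0\}$$ satisfies $\mu^*>0$. (Infima are taken in $[-\infty,+\infty]$, with $\inf\emptyset=+\infty$.) -/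

import Mathlib

noncomputable section

namespace UnboundedOp

variable {𝕜 H : Type*} [RCLike 𝕜] [NormedAddCommGroup H] [InnerProductSpace 𝕜 H]

/-- The map `T - z`, defined on the domain of `T`. -/
def shift (T : H →ₗ.[𝕜] H) (z : 𝕜) : T.domain →ₗ[𝕜] H :=
  T.toFun - z • T.domain.subtype

/-- The eigenspace of `T` for `z`: all `v` in the domain of `T` with `T v = z v`
(it is zero when `z` is not an eigenvalue). -/
def eigenspace (T : H →ₗ.[𝕜] H) (z : 𝕜) : Submodule 𝕜 T.domain :=
  LinearMap.ker (shift T z)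

/-- `z` is an eigenvalue of `T`. -/
def IsEigenvalue (T : H →ₗ.[𝕜] H) (z : 𝕜) : Prop :=
  eigenspace T z ≠ ⊥

/-- The index of negativity: the sum of the dimensions of the eigenspaces of `T` over all
negative real numbers, i.e. the number of negative eigenvalues counted with multiplicity. -/
def index {𝕜 : Type*} {H : Type*} [RCLike 𝕜] [NormedAddCommGroup H] [InnerProductSpace 𝕜 H]
    (T : H →ₗ.[𝕜] H) : Cardinal :=
  Cardinal.sum fun t : Set.Iio (0 : ℝ) => Module.rank 𝕜 (eigenspace T ((t : ℝ) : 𝕜))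

/-- The resolvent set: all `z` for which `T - z`, from the domain of `T` to `H`, has a bounded
everywhere defined two-sided inverse `R`. -/
def resolventSet (T : H →ₗ.[𝕜] H) : Set 𝕜 :=
  {z | ∃ R : H →L[𝕜] H,
    (∀ x : T.domain, R (shift T z x) = x) ∧
    ∀ y : H, ∃ x : T.domain, (x : H) = R y ∧ shift T z x = y}

/-- The spectrum of `T`. -/
def spectrum (T : H →ₗ.[𝕜] H) : Set 𝕜 :=
  (resolventSet T)ᶜ

/-- The bottom of the nonnegative spectrum of `T`: the infimum of `σ(T) ∩ [0, ∞)`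
(in `[-∞, ∞]`, so that the infimum of the empty set is `+∞`). -/
def bottomNonneg (T : H →ₗ.[𝕜] H) : EReal :=
  ⨅ t ∈ {t : ℝ | 0 ≤ t ∧ (t : 𝕜) ∈ spectrum T}, (t : EReal)

/-- The infimum of `⟨T v, v⟩` over the unit vectors `v` in the domain of `T` orthogonal to `f`
(in `[-∞, ∞]`, so that the infimum of the empty set is `+∞`). -/
def infOrthogonal (T : H →ₗ.[𝕜] H) (f : H) : EReal :=
  ⨅ v ∈ {v : T.domain | ‖(v : H)‖ = 1 ∧ inner 𝕜 (v : H) f = 0},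
    ((RCLike.re (inner 𝕜 (T v) (v : H)) : ℝ) : EReal)

end UnboundedOp

end

noncomputable section

namespace UnboundedOp

open RCLike

variable {𝕜 H : Type*} [RCLike 𝕜] [NormedAddCommGroup H] [InnerProductSpace 𝕜 H]

/-! Since `⟪T f*, f*⟫ < 0`, `T` has a negative eigenvalue `-l`, simple and unique by the index
bound; let `e` be a unit eigenvector. On `eᗮ` the form of `T` is nonnegative, so on `v = a e + w` it
is Lorentzian: `-l‖a‖² + ⟪T w, w⟫`. Orthogonality to `f = T f*` is `T`-orthogonality to the negative
vector `f*`, and Cauchy–Schwarz on `eᗮ` gives `l‖a‖² ≤ θ⟪T w, w⟫` with `θ < 1`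
(`exists_contraction`). This yields (a), the null case being excluded by `ker T = 0`; (b) uses in
addition `T ≥ c > 0` on `eᗮ`.

The lower bounds on `T` avoid the spectral theorem. Resolvent norms control the distance to the
spectrum, a gap `(a, b)` gives `(T - a)(T - b) ≥ 0`, and Cauchy–Schwarz with density of a range
gives `T ≥ b` off the bottom eigenspace (`mul_norm_sq_le_re_inner_of_gap`). -/

theorem shift_apply (T : H →ₗ.[𝕜] H) (z : 𝕜) (x : T.domain) :
    shift T z x = T x - z • (x : H) := rfl

/-- Cauchy–Schwarz for the positive semidefinite form `(x, y) ↦ ⟪S x, J y⟫`. -/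
theorem norm_inner_sq_le_of_nonneg {E : Type*} [AddCommGroup E] [Module 𝕜 E]
    (S J : E →ₗ[𝕜] H) (hsymm : ∀ x y, inner 𝕜 (S x) (J y) = inner 𝕜 (J x) (S y))
    (hpos : ∀ x, 0 ≤ re (inner 𝕜 (S x) (J x))) (x y : E) :
    ‖inner 𝕜 (S x) (J y)‖ ^ 2 ≤ re (inner 𝕜 (S x) (J x)) * re (inner 𝕜 (S y) (J y)) := by
  let core : PreInnerProductSpace.Core 𝕜 E :=
    { inner := fun x y => inner 𝕜 (S x) (J y)
      conj_inner_symm := fun x y => by rw [inner_conj_symm, hsymm]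
      re_inner_nonneg := hpos
      add_left := fun x y z => by rw [map_add, inner_add_left]
      smul_left := fun x y r => by rw [map_smul, inner_smul_left] }
  have h := @InnerProductSpace.Core.inner_mul_inner_self_le 𝕜 E _ _ _ core x y
  change ‖inner 𝕜 (S x) (J y)‖ * ‖inner 𝕜 (S y) (J x)‖ ≤ _ at h
  rw [hsymm y x, norm_inner_symm (J y), ← sq] at h
  exact h

/-- The norm of a symmetric bounded operator, or its opposite, is an approximate eigenvalue. -/
theorem norm_eq_zero_of_bounded_below (R : H →L[𝕜] H)
    (hR : ∀ u v, inner 𝕜 (R u) v = inner 𝕜 u (R v)) {K₁ K₂ : ℝ}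
    (hK₁ : 0 < K₁) (hK₂ : 0 < K₂)
    (h₁ : ∀ y, ‖y‖ ≤ K₁ * ‖(‖R‖ : 𝕜) • y - R y‖)
    (h₂ : ∀ y, ‖y‖ ≤ K₂ * ‖(‖R‖ : 𝕜) • y + R y‖) : ‖R‖ = 0 := by
  by_contra hne
  have hn : 0 < ‖R‖ := lt_of_le_of_ne (norm_nonneg _) (Ne.symm hne)
  set n := ‖R‖ with hndef
  -- `n² - R² = (n + R)(n - R)` is bounded below; expanding `‖(n² - R²) y‖²` turns this into a fixed
  -- deficit in `‖R y‖²`, contradicting `n = ‖R‖`.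
  have key : ∀ y, ‖R y‖ ^ 2 ≤ (n ^ 2 - 1 / ((K₁ * K₂) ^ 2 * n ^ 2)) * ‖y‖ ^ 2 := by
    intro y
    have hb : ‖y‖ ≤ K₁ * K₂ * ‖((n : 𝕜) * n) • y - R (R y)‖ := by
      have e : (n : 𝕜) • ((n : 𝕜) • y - R y) + R ((n : 𝕜) • y - R y)
          = ((n : 𝕜) * n) • y - R (R y) := by
        rw [map_sub, map_smul, smul_sub, smul_smul]; abel
      calc ‖y‖ ≤ K₁ * ‖(n : 𝕜) • y - R y‖ := h₁ y
        _ ≤ K₁ * (K₂ * _) := by gcongr; exact h₂ _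
        _ = _ := by rw [e]; ring
    have hexp : ‖((n : 𝕜) * n) • y - R (R y)‖ ^ 2
        = n ^ 4 * ‖y‖ ^ 2 - 2 * (n ^ 2 * ‖R y‖ ^ 2) + ‖R (R y)‖ ^ 2 := by
      rw [@norm_sub_sq 𝕜, norm_smul, inner_smul_left, ← hR, ← ofReal_mul, conj_ofReal,
        re_ofReal_mul, inner_self_eq_norm_sq, norm_ofReal, abs_of_pos (mul_pos hn hn)]
      ring
    have hRR : ‖R (R y)‖ ^ 2 ≤ n ^ 2 * ‖R y‖ ^ 2 := by
      rw [← mul_pow]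
      exact pow_le_pow_left₀ (norm_nonneg _) (R.le_opNorm _) 2
    have hb2 : ‖y‖ ^ 2 ≤ (K₁ * K₂) ^ 2 * (n ^ 2 * (n ^ 2 * ‖y‖ ^ 2 - ‖R y‖ ^ 2)) := by
      calc ‖y‖ ^ 2 ≤ (K₁ * K₂ * ‖((n : 𝕜) * n) • y - R (R y)‖) ^ 2 :=
            pow_le_pow_left₀ (norm_nonneg _) hb 2
        _ = (K₁ * K₂) ^ 2 * ‖((n : 𝕜) * n) • y - R (R y)‖ ^ 2 := mul_pow _ _ _
        _ ≤ _ := by gcongr; rw [hexp]; linarith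
    have hK : 0 < (K₁ * K₂) ^ 2 * n ^ 2 := by positivity
    have := (div_le_iff₀' hK).2 (hb2.trans_eq (mul_assoc _ _ _).symm)
    rw [sub_mul, one_div_mul_eq_div]
    linarith
  set d := 1 / ((K₁ * K₂) ^ 2 * n ^ 2) with hd
  have hdpos : 0 < d := by positivity
  have hle : n ≤ √(n ^ 2 - d) := by
    refine R.opNorm_le_bound (Real.sqrt_nonneg _) fun y => ?_
    by_cases hy : ‖y‖ = 0
    · rw [norm_eq_zero.1 hy]; simp
    have hy2 : 0 < ‖y‖ ^ 2 := by positivity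
    have hq : 0 ≤ n ^ 2 - d := by
      by_contra hlt
      have := key y
      nlinarith [sq_nonneg ‖R y‖]
    refine (pow_le_pow_iff_left₀ (norm_nonneg _) (by positivity) two_ne_zero).1 ?_
    rw [mul_pow, Real.sq_sqrt hq]
    exact key y
  by_cases hq : 0 ≤ n ^ 2 - d
  · have := pow_le_pow_left₀ hn.le hle 2
    rw [Real.sq_sqrt hq] at this
    linarith
  · rw [Real.sqrt_eq_zero_of_nonpos (by linarith)] at hle
    linarith

/-! ### Spectral gaps and lower bounds. -/

variable {T : H →ₗ.[𝕜] H}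

theorem exists_norm_le_of_mem_resolventSet {z : 𝕜} (hz : z ∈ resolventSet T) :
    ∃ K : ℝ, 0 < K ∧ ∀ x : T.domain, ‖(x : H)‖ ≤ K * ‖shift T z x‖ := by
  obtain ⟨R, hR, -⟩ := hz
  refine ⟨‖R‖ + 1, by positivity, fun x => ?_⟩
  calc ‖(x : H)‖ = ‖R (shift T z x)‖ := by rw [hR]
    _ ≤ ‖R‖ * ‖shift T z x‖ := R.le_opNorm _
    _ ≤ _ := by gcongr; linarith

theorem inner_shift_left (hsymm : T.IsFormalAdjoint T) (c : ℝ) (x y : T.domain) :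
    inner 𝕜 (shift T (c : 𝕜) x) (y : H) = inner 𝕜 (x : H) (shift T (c : 𝕜) y) := by
  rw [shift_apply, shift_apply, inner_sub_left, inner_sub_right, hsymm, inner_smul_left,
    inner_smul_right, conj_ofReal]

/-- The resolvent at `c` has norm at most `1 / r` when the spectrum stays at distance `r`. -/
theorem mul_norm_le_norm_shift (hsymm : T.IsFormalAdjoint T) {c r : ℝ} (hr : 0 < r)
    (hres : ∀ s : ℝ, |s - c| < r → (s : 𝕜) ∈ resolventSet T) (x : T.domain) :
    r * ‖(x : H)‖ ≤ ‖shift T (c : 𝕜) x‖ := by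
  obtain ⟨R, hRx, hRy⟩ := hres c (by simpa using hr)
  have hRsymm : ∀ u v, inner 𝕜 (R u) v = inner 𝕜 u (R v) := by
    intro u v
    obtain ⟨a, ha, rfl⟩ := hRy u
    obtain ⟨b, hb, rfl⟩ := hRy v
    rw [hRx, hRx, inner_shift_left hsymm]
  suffices hn : ‖R‖ ≤ 1 / r by
    have h1 : ‖(x : H)‖ ≤ 1 / r * ‖shift T (c : 𝕜) x‖ := by
      calc ‖(x : H)‖ = ‖R (shift T (c : 𝕜) x)‖ := by rw [hRx]
        _ ≤ ‖R‖ * _ := R.le_opNorm _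
        _ ≤ _ := by gcongr
    rwa [one_div_mul_eq_div, le_div_iff₀' hr] at h1
  by_contra! hlt
  have hn : 0 < ‖R‖ := lt_trans (by positivity) hlt
  have hs : ‖R‖⁻¹ < r := by
    rw [one_div] at hlt
    exact inv_lt_of_inv_lt₀ hr hlt
  -- The point `c + σ‖R‖⁻¹` lies within `r` of `c`, and `T` minus it sends `R y` to `‖R‖⁻¹(‖R‖ y - σ
  -- R y)`.
  have bound : ∀ σ : ℝ, |σ| = 1 → ∃ K : ℝ, 0 < K ∧
      ∀ y, ‖y‖ ≤ K * ‖(‖R‖ : 𝕜) • y - (σ : 𝕜) • R y‖ := by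
    intro σ hσ
    have hmem := hres (c + σ * ‖R‖⁻¹) (by
      rwa [add_sub_cancel_left, abs_mul, hσ, one_mul, abs_of_pos (inv_pos.2 hn)])
    obtain ⟨K, hK, hKb⟩ := exists_norm_le_of_mem_resolventSet hmem
    refine ⟨(1 + K * ‖R‖⁻¹) * ‖R‖⁻¹, by positivity, fun y => ?_⟩
    obtain ⟨a, ha, hay⟩ := hRy y
    have hn' : (‖R‖ : 𝕜) ≠ 0 := ofReal_ne_zero.2 hn.ne'
    have e : shift T ((c + σ * ‖R‖⁻¹ : ℝ) : 𝕜) a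
        = ((‖R‖⁻¹ : ℝ) : 𝕜) • ((‖R‖ : 𝕜) • y - (σ : 𝕜) • R y) := by
      have h0 : T a = y + (c : 𝕜) • R y := by
        rw [← ha, ← sub_eq_iff_eq_add, ← shift_apply, hay]
      rw [shift_apply, h0, ha, smul_sub, smul_smul, smul_smul, ofReal_inv, inv_mul_cancel₀ hn',
        one_smul, ofReal_add, add_smul, ofReal_mul, ofReal_inv, mul_comm (σ : 𝕜)]
      abel
    set z := (‖R‖ : 𝕜) • y - (σ : 𝕜) • R y with hz
    have h1 : ‖R y‖ ≤ K * (‖R‖⁻¹ * ‖z‖) := by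
      have := hKb a
      rwa [e, ha, norm_smul, norm_ofReal, abs_of_pos (inv_pos.2 hn)] at this
    have h2 : ‖R‖ * ‖y‖ ≤ ‖z‖ + ‖R y‖ := by
      have : (‖R‖ : 𝕜) • y = z + (σ : 𝕜) • R y := by rw [hz]; abel
      calc ‖R‖ * ‖y‖ = ‖(‖R‖ : 𝕜) • y‖ := by rw [norm_smul, norm_ofReal, abs_norm]
        _ ≤ ‖z‖ + ‖(σ : 𝕜) • R y‖ := by rw [this]; exact norm_add_le _ _
        _ = _ := by rw [norm_smul, norm_ofReal, hσ, one_mul]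
    calc ‖y‖ = ‖R‖⁻¹ * (‖R‖ * ‖y‖) := by field_simp
      _ ≤ ‖R‖⁻¹ * (‖z‖ + K * (‖R‖⁻¹ * ‖z‖)) := by gcongr; linarith
      _ = _ := by ring
  obtain ⟨K₁, hK₁, h₁⟩ := bound 1 (by simp)
  obtain ⟨K₂, hK₂, h₂⟩ := bound (-1) (by simp)
  refine hn.ne' (norm_eq_zero_of_bounded_below R hRsymm hK₁ hK₂ (fun y => ?_) fun y => ?_)
  · simpa using h₁ y
  · simpa using h₂ y

/-- If `(a, b)` is a gap in the spectrum, then `(T - a)(T - b) ≥ 0`. -/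
theorem mul_re_inner_shift_le (hsymm : T.IsFormalAdjoint T) {a b : ℝ} (hab : a < b)
    (hres : ∀ s : ℝ, a < s → s < b → (s : 𝕜) ∈ resolventSet T) (x : T.domain) :
    (b - a) * re (inner 𝕜 (shift T (a : 𝕜) x) (x : H)) ≤ ‖shift T (a : 𝕜) x‖ ^ 2 := by
  -- Center and radius of the gap: after squaring, the `‖x‖²` terms cancel.
  have h := mul_norm_le_norm_shift (c := (a + b) / 2) (r := (b - a) / 2) hsymm (by linarith)
    (fun s hs => by
      rw [abs_lt] at hs
      exact hres s (by linarith) (by linarith)) x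
  have e : shift T (((a + b) / 2 : ℝ) : 𝕜) x
      = shift T (a : 𝕜) x - (((b - a) / 2 : ℝ) : 𝕜) • (x : H) := by
    have : (((a + b) / 2 : ℝ) : 𝕜) = (a : 𝕜) + (((b - a) / 2 : ℝ) : 𝕜) := by
      rw [← ofReal_add]; congr 1; ring
    rw [shift_apply, shift_apply, this, add_smul]; abel
  have h2 := pow_le_pow_left₀ (mul_nonneg (by linarith) (norm_nonneg _)) h 2
  rw [e, @norm_sub_sq 𝕜, inner_smul_right, re_ofReal_mul, norm_smul, norm_ofReal, mul_pow,
    mul_pow, sq_abs] at h2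
  linarith

/-- Every `(b - N, b)` is a gap; its inequality reduces to `0 ≤ ‖(T - b) x‖² + N p`, which fails for
large `N` if `p < 0`. -/
theorem re_inner_shift_nonneg (hsymm : T.IsFormalAdjoint T) {b : ℝ}
    (hres : ∀ s : ℝ, s < b → (s : 𝕜) ∈ resolventSet T) (x : T.domain) :
    0 ≤ re (inner 𝕜 (shift T (b : 𝕜) x) (x : H)) := by
  set p := re (inner 𝕜 (shift T (b : 𝕜) x) (x : H)) with hp
  have key : ∀ N : ℝ, 0 < N → 0 ≤ ‖shift T (b : 𝕜) x‖ ^ 2 + N * p := by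
    intro N hN
    have h := mul_re_inner_shift_le hsymm (a := b - N) (b := b) (by linarith)
      (fun s _ hs => hres s hs) x
    have e : shift T ((b - N : ℝ) : 𝕜) x = shift T (b : 𝕜) x + (N : 𝕜) • (x : H) := by
      rw [shift_apply, shift_apply, ofReal_sub, sub_smul]; abel
    rw [e, @norm_add_sq 𝕜, inner_add_left, inner_smul_left, inner_smul_right, conj_ofReal,
      map_add, re_ofReal_mul, re_ofReal_mul, inner_self_eq_norm_sq, ← hp, norm_smul, norm_ofReal,
      mul_pow, sq_abs] at h
    linarith
  by_contra! hlt
  have hN : 0 < (‖shift T (b : 𝕜) x‖ ^ 2 + 1) / (-p) := by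
    have := neg_pos.2 hlt
    positivity
  have := key _ hN
  have e : (‖shift T (b : 𝕜) x‖ ^ 2 + 1) / (-p) * p = -(‖shift T (b : 𝕜) x‖ ^ 2 + 1) := by
    field_simp [hlt.ne]
  rw [e] at this
  linarith

/-- By self-adjointness, a vector orthogonal to the range of `T - c` lies in the domain and in `ker
(T - c)`. -/
theorem mem_closure_range_shift [CompleteSpace H] (hdense : Dense (T.domain : Set H))
    (hT : IsSelfAdjoint T) (c : ℝ) {y : H}
    (hy : ∀ u : T.domain, shift T (c : 𝕜) u = 0 → inner 𝕜 (u : H) y = 0) :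
    y ∈ closure (Set.range (shift T (c : 𝕜))) := by
  have hsub : y ∈ (LinearMap.range (shift T (c : 𝕜)))ᗮᗮ := by
    rw [Submodule.mem_orthogonal]
    intro u hu
    rw [Submodule.mem_orthogonal] at hu
    have hu' : ∀ x : T.domain, inner 𝕜 ((c : 𝕜) • u) (x : H) = inner 𝕜 u (T x) := by
      intro x
      have h := hu (shift T (c : 𝕜) x) ⟨x, rfl⟩
      rw [← inner_conj_symm, map_eq_zero, shift_apply, inner_sub_right, sub_eq_zero,
        inner_smul_right] at h
      rw [inner_smul_left, conj_ofReal, h]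
    have hmem : u ∈ T.adjoint.domain := LinearPMap.mem_adjoint_domain_of_exists u ⟨_, hu'⟩
    have happ := LinearPMap.adjoint_apply_eq hdense ⟨u, hmem⟩ hu'
    rw [LinearPMap.isSelfAdjoint_def] at hT
    obtain ⟨u', hu1, hu2⟩ : ∃ u' : T.domain, (u' : H) = u ∧ T u' = (c : 𝕜) • u := by
      have : T.adjoint ≤ T := hT.le
      exact ⟨⟨u, this.1 hmem⟩, rfl, by rw [← happ]; exact (this.2 rfl).symm⟩
    rw [← hu1]
    exact hy u' (by rw [shift_apply, hu2, hu1, sub_self])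
  rwa [Submodule.orthogonal_orthogonal_eq_closure] at hsub

/-- If `T ≥ a` and `(a, b)` is a gap in the spectrum, then `T ≥ b` on `ker (T - a)ᗮ`. -/
theorem mul_norm_sq_le_re_inner_of_gap [CompleteSpace H] (hdense : Dense (T.domain : Set H))
    (hT : IsSelfAdjoint T) (hsymm : T.IsFormalAdjoint T) {a b : ℝ} (hab : a < b)
    (hlow : ∀ s : ℝ, s < a → (s : 𝕜) ∈ resolventSet T)
    (hres : ∀ s : ℝ, a < s → s < b → (s : 𝕜) ∈ resolventSet T) (y : T.domain)
    (hy : ∀ u : T.domain, shift T (a : 𝕜) u = 0 → inner 𝕜 (u : H) (y : H) = 0) :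
    b * ‖(y : H)‖ ^ 2 ≤ re (inner 𝕜 (T y) (y : H)) := by
  set B := shift T (a : 𝕜) with hB
  set q := re (inner 𝕜 (B y) (y : H)) with hq
  have hq0 : 0 ≤ q := re_inner_shift_nonneg hsymm hlow y
  -- The inequality is proved for `z` in the range of `T - a`, extends to its closure, and is then
  -- used at `z = y`.
  have hclosed : IsClosed {z : H | (b - a) * ‖inner 𝕜 z (y : H)‖ ^ 2 ≤ ‖z‖ ^ 2 * q} :=
    isClosed_le (by fun_prop) (by fun_prop)
  have hsub : closure (Set.range B) ⊆
      {z : H | (b - a) * ‖inner 𝕜 z (y : H)‖ ^ 2 ≤ ‖z‖ ^ 2 * q} := by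
    refine closure_minimal ?_ hclosed
    rintro _ ⟨x, rfl⟩
    have h1 := norm_inner_sq_le_of_nonneg B T.domain.subtype
      (fun x y => inner_shift_left hsymm a x y) (fun x => re_inner_shift_nonneg hsymm hlow x) x y
    have h2 := mul_re_inner_shift_le hsymm hab hres x
    change (b - a) * ‖inner 𝕜 (B x) (y : H)‖ ^ 2 ≤ _
    calc (b - a) * ‖inner 𝕜 (B x) (y : H)‖ ^ 2
        ≤ (b - a) * (re (inner 𝕜 (B x) (x : H)) * q) :=
          mul_le_mul_of_nonneg_left h1 (by linarith)
      _ = ((b - a) * re (inner 𝕜 (B x) (x : H))) * q := by ring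
      _ ≤ _ := mul_le_mul_of_nonneg_right h2 hq0
  have h := hsub (mem_closure_range_shift hdense hT a hy)
  change (b - a) * ‖inner 𝕜 (y : H) (y : H)‖ ^ 2 ≤ ‖(y : H)‖ ^ 2 * q at h
  have hqe : q = re (inner 𝕜 (T y) (y : H)) - a * ‖(y : H)‖ ^ 2 := by
    rw [hq, hB, shift_apply, inner_sub_left, inner_smul_left, conj_ofReal, map_sub, re_ofReal_mul,
      inner_self_eq_norm_sq]
  rw [inner_self_eq_norm_sq_to_K, norm_pow, norm_ofReal, abs_norm] at h
  by_cases h0 : ‖(y : H)‖ = 0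
  · rw [norm_eq_zero.1 h0]; simp
  have hpos : 0 < ‖(y : H)‖ ^ 2 := by positivity
  have : (b - a) * ‖(y : H)‖ ^ 2 ≤ q := by
    refine le_of_mul_le_mul_left ?_ hpos
    linarith
  linarith

/-! ### The single negative eigenvalue. -/

theorem negative_eigenvalue_unique (hind : index T ≤ 1) {s t : ℝ} (hs : s < 0) (ht : t < 0)
    (hes : IsEigenvalue T (s : 𝕜)) (het : IsEigenvalue T (t : 𝕜)) : s = t := by
  have hsub : Subsingleton (Σ t : Set.Iio (0 : ℝ),
      (Module.rank 𝕜 (eigenspace T ((t : ℝ) : 𝕜))).out) :=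
    Cardinal.le_one_iff_subsingleton.1 hind
  have hne : ∀ r : ℝ, IsEigenvalue T (r : 𝕜) →
      Nonempty (Module.rank 𝕜 (eigenspace T (r : 𝕜))).out := by
    intro r hr
    rw [← Cardinal.mk_ne_zero_iff, Cardinal.mk_out]
    intro h0
    exact hr (Submodule.rank_eq_zero.1 h0)
  obtain ⟨p⟩ := hne s hes
  obtain ⟨q⟩ := hne t het
  have := congrArg (fun z => (z.1 : ℝ)) (Subsingleton.elim
    (⟨⟨s, hs⟩, p⟩ : Σ t : Set.Iio (0 : ℝ), (Module.rank 𝕜 (eigenspace T ((t : ℝ) : 𝕜))).out)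
    ⟨⟨t, ht⟩, q⟩)
  exact this

theorem rank_eigenspace_le_one (hind : index T ≤ 1) {t : ℝ} (ht : t < 0) :
    Module.rank 𝕜 (eigenspace T (t : 𝕜)) ≤ 1 :=
  (Cardinal.le_sum (fun t : Set.Iio (0 : ℝ) => Module.rank 𝕜 (eigenspace T ((t : ℝ) : 𝕜)))
    ⟨t, ht⟩).trans hind

/-- Outside one simple negative eigenvalue with unit eigenvector `e`, the operator is bounded
below by every `c ≥ 0` such that `[0, c)` contains no spectrum. -/
theorem exists_unit_eigenvector [CompleteSpace H] (hdense : Dense (T.domain : Set H))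
    (hT : IsSelfAdjoint T) (hsymm : T.IsFormalAdjoint T)
    (hneg : ∀ t : ℝ, t < 0 → (t : 𝕜) ∈ spectrum T → IsEigenvalue T (t : 𝕜))
    (hind : index T ≤ 1) (hex : ∃ x : T.domain, re (inner 𝕜 (T x) (x : H)) < 0) :
    ∃ (l : ℝ) (e : T.domain), 0 < l ∧ ‖(e : H)‖ = 1 ∧ T e = -((l : 𝕜) • (e : H)) ∧
      ∀ c : ℝ, 0 ≤ c → (∀ s : ℝ, 0 ≤ s → s < c → (s : 𝕜) ∈ resolventSet T) →
        ∀ y : T.domain, inner 𝕜 (e : H) (y : H) = 0 →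
          c * ‖(y : H)‖ ^ 2 ≤ re (inner 𝕜 (T y) (y : H)) := by
  -- Otherwise the whole negative axis is resolvent and `T ≥ 0`.
  obtain ⟨t, ht, hte⟩ : ∃ t : ℝ, t < 0 ∧ IsEigenvalue T (t : 𝕜) := by
    by_contra! hno
    obtain ⟨x, hx⟩ := hex
    have h := re_inner_shift_nonneg hsymm (b := 0)
      (fun s hs => by_contra fun hs' => hno s hs (hneg s hs hs')) x
    rw [shift_apply, ofReal_zero, zero_smul, sub_zero] at h
    linarith
  obtain ⟨⟨v, hv⟩, hspan⟩ := rank_le_one_iff.1 (rank_eigenspace_le_one hind ht)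
  have hv0 : (v : H) ≠ 0 := by
    intro h0
    refine hte ((Submodule.eq_bot_iff _).2 fun x hx => ?_)
    obtain ⟨r, hr⟩ := hspan ⟨x, hx⟩
    have hr' : r • v = x := congrArg Subtype.val hr
    have hv' : v = 0 := Subtype.ext h0
    rw [← hr', hv', smul_zero]
  have hnv : ‖(v : H)‖ ≠ 0 := norm_ne_zero_iff.2 hv0
  have hTv : T v = (t : 𝕜) • (v : H) := by
    rw [← sub_eq_zero]; exact hv
  refine ⟨-t, ((‖(v : H)‖⁻¹ : ℝ) : 𝕜) • v, by linarith, ?_, ?_, ?_⟩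
  · rw [Submodule.coe_smul, norm_smul, norm_ofReal, abs_inv, abs_norm, inv_mul_cancel₀ hnv]
  · rw [LinearPMap.map_smul, hTv, Submodule.coe_smul, smul_comm, ofReal_neg, neg_smul, neg_neg]
  · intro c hc hgap y hy
    have hother : ∀ s : ℝ, s < 0 → s ≠ t → (s : 𝕜) ∈ resolventSet T := fun s hs hst =>
      by_contra fun hs' =>
        hst (negative_eigenvalue_unique hind hs ht (hneg s hs hs') hte)
    refine mul_norm_sq_le_re_inner_of_gap hdense hT hsymm (a := t) (by linarith)
      (fun s hs => hother s (by linarith) hs.ne) (fun s hs hsc => ?_) y fun u hu => ?_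
    · rcases lt_or_ge s 0 with h | h
      · exact hother s h hs.ne'
      · exact hgap s h hsc
    · obtain ⟨r, hr⟩ := hspan ⟨u, hu⟩
      have hr' : r • v = u := congrArg Subtype.val hr
      rw [Submodule.coe_smul, inner_smul_left, conj_ofReal, mul_eq_zero, ofReal_eq_zero,
        inv_eq_zero] at hy
      rw [← hr', Submodule.coe_smul, inner_smul_left, hy.resolve_left hnv, mul_zero]

/-- The vectors of the domain of `T` orthogonal to `e`. -/
def domainOrthogonal (T : H →ₗ.[𝕜] H) (e : H) : Submodule 𝕜 T.domain :=
  LinearMap.ker ((innerₛₗ 𝕜 e).comp T.domain.subtype)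

theorem norm_inner_sq_le_of_orthogonal (hsymm : T.IsFormalAdjoint T) {e : H}
    (hpos : ∀ y : T.domain, inner 𝕜 e (y : H) = 0 → 0 ≤ re (inner 𝕜 (T y) (y : H)))
    {x y : T.domain} (hx : inner 𝕜 e (x : H) = 0) (hy : inner 𝕜 e (y : H) = 0) :
    ‖inner 𝕜 (T x) (y : H)‖ ^ 2
      ≤ re (inner 𝕜 (T x) (x : H)) * re (inner 𝕜 (T y) (y : H)) :=
  norm_inner_sq_le_of_nonneg (T.toFun.comp (domainOrthogonal T e).subtype)
    (T.domain.subtype.comp (domainOrthogonal T e).subtype) (fun x y => hsymm x y)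
    (fun x => hpos x x.2) ⟨x, hx⟩ ⟨y, hy⟩

theorem exists_orthogonal_decomposition {e : T.domain} (he : ‖(e : H)‖ = 1) (v : T.domain) :
    ∃ (a : 𝕜) (w : T.domain), v = a • e + w ∧ inner 𝕜 (e : H) (w : H) = 0 := by
  refine ⟨inner 𝕜 (e : H) (v : H), v - inner 𝕜 (e : H) (v : H) • e, by abel, ?_⟩
  rw [Submodule.coe_sub, Submodule.coe_smul, inner_sub_right, inner_smul_right,
    inner_self_eq_norm_sq_to_K, he]
  simp

/-- The cross terms vanish because `T e` is a multiple of `e`. -/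
theorem inner_decomposition (hsymm : T.IsFormalAdjoint T) {l : ℝ} {e : T.domain}
    (he : ‖(e : H)‖ = 1) (hTe : T e = -((l : 𝕜) • (e : H))) (a b : 𝕜) {w g : T.domain}
    (hw : inner 𝕜 (e : H) (w : H) = 0) (hg : inner 𝕜 (e : H) (g : H) = 0) :
    inner 𝕜 (T (a • e + w)) ((b • e + g : T.domain) : H)
      = -(l * (starRingEnd 𝕜 a * b)) + inner 𝕜 (T w) (g : H) := by
  have h1 : inner 𝕜 (T w) (e : H) = 0 := by
    rw [hsymm, hTe, inner_neg_right, inner_smul_right, ← inner_conj_symm, hw]; simp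
  rw [LinearPMap.map_add, LinearPMap.map_smul, hTe, Submodule.coe_add, Submodule.coe_smul,
    inner_add_left, inner_add_right, inner_add_right]
  simp only [inner_smul_left, inner_smul_right, inner_neg_left, h1, hg, conj_ofReal,
    inner_self_eq_norm_sq_to_K, he]
  simp
  ring

/-- With `θ < 1` depending only on `fstar`, the form of `T` at a vector `v = a e + w` that is
`T`-orthogonal to the negative vector `fstar` dominates `(1 - θ)⟪T w, w⟫`. -/
theorem exists_contraction (hsymm : T.IsFormalAdjoint T) {l : ℝ} {e : T.domain} (hl : 0 < l)
    (he : ‖(e : H)‖ = 1) (hTe : T e = -((l : 𝕜) • (e : H)))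
    (hpos : ∀ y : T.domain, inner 𝕜 (e : H) (y : H) = 0 → 0 ≤ re (inner 𝕜 (T y) (y : H)))
    {fstar : T.domain} (hf : re (inner 𝕜 (T fstar) (fstar : H)) < 0) :
    ∃ θ : ℝ, 0 ≤ θ ∧ θ < 1 ∧ ∀ v : T.domain, inner 𝕜 (v : H) (T fstar) = 0 →
      ∃ (a : 𝕜) (w : T.domain), v = a • e + w ∧ inner 𝕜 (e : H) (w : H) = 0 ∧
        l * ‖a‖ ^ 2 ≤ θ * re (inner 𝕜 (T w) (w : H)) ∧
        re (inner 𝕜 (T v) (v : H)) = re (inner 𝕜 (T w) (w : H)) - l * ‖a‖ ^ 2 := by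
  have hre : ∀ (a : 𝕜) (w : T.domain), inner 𝕜 (e : H) (w : H) = 0 →
      re (inner 𝕜 (T (a • e + w)) ((a • e + w : T.domain) : H))
        = re (inner 𝕜 (T w) (w : H)) - l * ‖a‖ ^ 2 := by
    intro a w hw
    rw [inner_decomposition hsymm he hTe a a hw hw, RCLike.conj_mul, map_add, map_neg, re_ofReal_mul,
      ← ofReal_pow, ofReal_re]
    ring
  obtain ⟨b, g, rfl, hg⟩ := exists_orthogonal_decomposition he fstar
  rw [hre b g hg] at hf
  have hG := hpos g hg
  set G := re (inner 𝕜 (T g) (g : H))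
  have hb : 0 < l * ‖b‖ ^ 2 := by linarith
  refine ⟨G / (l * ‖b‖ ^ 2), by positivity, by rw [div_lt_one hb]; linarith, fun v hv => ?_⟩
  obtain ⟨a, w, rfl, hw⟩ := exists_orthogonal_decomposition he v
  refine ⟨a, w, rfl, hw, ?_, hre a w hw⟩
  -- The orthogonality becomes `l ā b = ⟪T w, g⟫`, to be squared by Cauchy–Schwarz.
  rw [← hsymm, inner_decomposition hsymm he hTe a b hw hg, neg_add_eq_zero] at hv
  have hcs := norm_inner_sq_le_of_orthogonal hsymm hpos hw hg
  rw [← hv, norm_mul, norm_mul, norm_ofReal, abs_of_pos hl, norm_conj] at hcs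
  rw [div_mul_eq_mul_div, le_div_iff₀ hb]
  linarith

/-- By Cauchy–Schwarz on `eᗮ`, a null `w` has `T w` orthogonal to the dense domain. -/
theorem eq_zero_of_re_inner_eq_zero (hdense : Dense (T.domain : Set H))
    (hsymm : T.IsFormalAdjoint T) (hker : LinearMap.ker T.toFun = ⊥) {l : ℝ} {e : T.domain}
    (he : ‖(e : H)‖ = 1) (hTe : T e = -((l : 𝕜) • (e : H)))
    (hpos : ∀ y : T.domain, inner 𝕜 (e : H) (y : H) = 0 → 0 ≤ re (inner 𝕜 (T y) (y : H)))
    {w : T.domain} (hw : inner 𝕜 (e : H) (w : H) = 0)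
    (hw0 : re (inner 𝕜 (T w) (w : H)) = 0) : w = 0 := by
  have hTw : T w = 0 := by
    refine hdense.eq_zero_of_inner_left 𝕜 fun u hu => ?_
    obtain ⟨b, g, hbg, hg⟩ := exists_orthogonal_decomposition he ⟨u, hu⟩
    have hcs := norm_inner_sq_le_of_orthogonal hsymm hpos hw hg
    rw [hw0, zero_mul] at hcs
    have h0 : inner 𝕜 (T w) (g : H) = 0 := by
      rw [← norm_eq_zero, ← sq_eq_zero_iff]
      exact le_antisymm hcs (sq_nonneg _)
    have h1 := inner_decomposition hsymm he hTe 0 b hw hg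
    rw [← hbg, zero_smul, zero_add, h0] at h1
    simpa using h1
  have : w ∈ LinearMap.ker T.toFun := hTw
  rwa [hker] at this

end UnboundedOp

end

theorem lemma4p1 {𝕜 : Type*} {H : Type*} [RCLike 𝕜] [NormedAddCommGroup H]
    [InnerProductSpace 𝕜 H] [CompleteSpace H]
    (T : H →ₗ.[𝕜] H) (hdense : Dense (T.domain : Set H)) (hT : IsSelfAdjoint T)
    (hneg : ∀ t : ℝ, t < 0 → (t : 𝕜) ∈ UnboundedOp.spectrum T →
      UnboundedOp.IsEigenvalue T (t : 𝕜))
    (hker : LinearMap.ker T.toFun = ⊥)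
    (hind : UnboundedOp.index T ≤ 1)
    (f : H)
    (hf : ∃ fstar : T.domain, T fstar = f ∧ RCLike.re (inner 𝕜 f (fstar : H)) < 0) :
    (∀ v : T.domain, v ≠ 0 → inner 𝕜 (v : H) f = 0 →
      0 < RCLike.re (inner 𝕜 (T v) (v : H))) ∧
    (0 < UnboundedOp.bottomNonneg T → 0 < UnboundedOp.infOrthogonal T f) := by
  obtain ⟨fstar, rfl, hf⟩ := hf
  have hsymm : T.IsFormalAdjoint T := by
    have h := LinearPMap.adjoint_isFormalAdjoint hdense
    rwa [LinearPMap.isSelfAdjoint_def.1 hT] at h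
  obtain ⟨l, e, hl, he, hTe, hlow⟩ :=
    UnboundedOp.exists_unit_eigenvector hdense hT hsymm hneg hind ⟨fstar, hf⟩
  have hpos : ∀ y : T.domain, inner 𝕜 (e : H) (y : H) = 0 →
      0 ≤ RCLike.re (inner 𝕜 (T y) (y : H)) := fun y hy => by
    simpa using hlow 0 le_rfl (fun s h h' => absurd h h'.not_ge) y hy
  obtain ⟨θ, hθ0, hθ1, hθ⟩ := UnboundedOp.exists_contraction hsymm hl he hTe hpos hf
  constructor
  · intro v hv0 hv
    obtain ⟨a, w, rfl, hw, ha, hq⟩ := hθ v hv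
    rw [hq]
    have hwpos := hpos w hw
    rcases hwpos.lt_or_eq with hlt | heq
    · nlinarith
    · have hw0 := UnboundedOp.eq_zero_of_re_inner_eq_zero hdense hsymm hker he hTe hpos hw heq.symm
      rw [← heq, mul_zero] at ha
      have ha2 : ‖a‖ ^ 2 = 0 := by nlinarith [sq_nonneg ‖a‖]
      have ha0 : a = 0 := by simpa using ha2
      exact absurd (by rw [hw0, ha0]; simp) hv0
  · intro hbot
    -- A finite `c` strictly below the bottom also covers a bottom equal to `+∞`.
    obtain ⟨c, hc0, hc⟩ := EReal.lt_iff_exists_real_btwn.1 hbot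
    have hc0 : 0 < c := by exact_mod_cast hc0
    have hgap : ∀ s : ℝ, 0 ≤ s → s < c → (s : 𝕜) ∈ UnboundedOp.resolventSet T := by
      intro s hs hsc
      by_contra hmem
      have : UnboundedOp.bottomNonneg T ≤ (s : EReal) := iInf₂_le s ⟨hs, hmem⟩
      have := hc.trans_le this
      exact absurd (EReal.coe_lt_coe_iff.1 this) hsc.not_gt
    have hden : 0 < θ / l + 1 / c := by positivity
    -- With `Q = ⟪T w, w⟫`, the form is at least `(1 - θ) Q`, while `1 = ‖a‖² + ‖w‖² ≤ (θ / l + 1 /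
    -- c) Q`.
    have hκ : 0 < (1 - θ) / (θ / l + 1 / c) := div_pos (by linarith) hden
    refine lt_of_lt_of_le (EReal.coe_pos.2 hκ) (le_iInf₂ ?_)
    rintro v ⟨hv1, hv⟩
    obtain ⟨a, w, rfl, hw, ha, hq⟩ := hθ v hv
    have hwc := hlow c hc0.le hgap w hw
    rw [EReal.coe_le_coe_iff, hq, div_le_iff₀ hden]
    set Q := RCLike.re (inner 𝕜 (T w) (w : H))
    have hnorm : ‖a‖ ^ 2 + ‖(w : H)‖ ^ 2 = 1 := by
      have h : ‖((a • e + w : T.domain) : H)‖ ^ 2 = 1 := by rw [hv1, one_pow]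
      rw [Submodule.coe_add, Submodule.coe_smul, @norm_add_sq 𝕜, inner_smul_left, hw, norm_smul,
        he] at h
      simpa using h
    have h1 : ‖a‖ ^ 2 ≤ θ / l * Q := by
      rw [div_mul_eq_mul_div, le_div_iff₀ hl]; linarith
    have h2 : ‖(w : H)‖ ^ 2 ≤ 1 / c * Q := by
      rw [one_div_mul_eq_div, le_div_iff₀ hc0]; linarith
    calc 1 - θ ≤ (1 - θ) * ((θ / l + 1 / c) * Q) := by
          have : 1 ≤ (θ / l + 1 / c) * Q := by linarith
          nlinarith
      _ = ((1 - θ) * Q) * (θ / l + 1 / c) := by ring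
      _ ≤ _ := mul_le_mul_of_nonneg_right (by linarith) hden.le
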